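/- Let $q$ be a prime power. Let $H(q)^D$ be the dual split Cayley hexagon: the point-line geometry whose lines are the $1$-dimensional subspaces of $\mathbb{F}_q^7$ on which the quadratic form $Q(x)=x_0x_4+x_1x_5+x_2x_6-x_3^2$ vanishes, whose points are the $2$-dimensional subspaces of $\mathbb{F}_q^7$ on which $Q$ vanishes and whose Grassmann coordinates $p_{ij}=x_iy_j-x_jy_i$ (for a basis $x,y$ of the subspace) satisfy $p_{12}=p_{34}$, $p_{54}=p_{32}$, $p_{20}=p_{35}$, $p_{65}=p_{30}$, $p_{01}=p_{36}$, $p_{46}=p_{31}$, and whose incidence is reverse containment. Let $H(q,1)$ be the generalized hexagon whose points are the incident point-line pairs of the Desarguesian projective plane $\mathrm{PG}(2,q)$, whose lines are the points and the lines of $\mathrm{PG}(2,q)$, and in which a pair is incident with its two members. A partial distance-$2$ ovoid of $H(q)^D$ is a set of points any two distinct members of which are at distance at least $2$ in the point graph, in which two distinct points are adjacent when they lie on a common line. An $H(q,1)$-subhexagon of $H(q)^D$ is a subgeometry, formed by a set of points and a set of lines of $H(q)^D$ with the induced incidence, that is isomorphic to $H(q,1)$. Let $\mathcal{O}$ be a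 partial distance-$2$ ovoid of $H(q)^D$, and suppose that no $H(q,1)$-subhexagon of $H(q)^D$ contains $q^2+q+1$ points of $\mathcal{O}$. Then $$|\mathcal{O}| \le (q^2-q+1)(q^2+q).$$ -/

import Mathlib

/-- A point-line geometry with point set `P`, line set `L` and incidence relation `inc`. -/
structure PointLineGeometry (P L : Type*) where
  inc : P → L → Prop

namespace PointLineGeometry

/-- The point graph: two distinct points are adjacent when they lie on a common line. -/
def pointGraph {P L : Type*} (S : PointLineGeometry P L) : SimpleGraph P where
  Adj x y := x ≠ y ∧ ∃ l : L, S.inc x l ∧ S.inc y l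
  symm := ⟨fun _ _ h => ⟨h.1.symm, h.2.imp fun _ hl => ⟨hl.2, hl.1⟩⟩⟩
  loopless := ⟨fun _ h => h.1 rfl⟩

/-- A partial distance-`j` ovoid: a set of points any two distinct members of which are at
distance at least `j` in the point graph (the distance is `⊤` between different components). -/
def IsPartialDistanceOvoid {P L : Type*} (S : PointLineGeometry P L) (j : ℕ) (O : Set P) : Prop :=
  ∀ x ∈ O, ∀ y ∈ O, x ≠ y → (j : ℕ∞) ≤ S.pointGraph.edist x y

/-- The subgeometry on a set of points and a set of lines, with the induced incidence. -/
def induce {P L : Type*} (S : PointLineGeometry P L) (P' : Set P) (L' : Set L) :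
    PointLineGeometry P' L' where
  inc x l := S.inc x l

/-- An isomorphism of point-line geometries (points to points, lines to lines). -/
structure Iso {P₁ L₁ P₂ L₂ : Type*} (S₁ : PointLineGeometry P₁ L₁)
    (S₂ : PointLineGeometry P₂ L₂) where
  onPoints : P₁ ≃ P₂
  onLines : L₁ ≃ L₂
  inc_iff : ∀ x l, S₁.inc x l ↔ S₂.inc (onPoints x) (onLines l)

end PointLineGeometry

/-- The points of the projective plane `PG(2, F)`: the 1-dimensional subspaces of `F³`. -/
def PlanePoint (F : Type*) [Field F] : Type _ :=
  {U : Submodule F (Fin 3 → F) // Module.finrank F U = 1}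

/-- The lines of the projective plane `PG(2, F)`: the 2-dimensional subspaces of `F³`. -/
def PlaneLine (F : Type*) [Field F] : Type _ :=
  {U : Submodule F (Fin 3 → F) // Module.finrank F U = 2}

/-- The flags (incident point-line pairs) of `PG(2, F)`. -/
def PlaneFlag (F : Type*) [Field F] : Type _ :=
  {f : PlanePoint F × PlaneLine F // f.1.1 ≤ f.2.1}

/-- The generalized hexagon `H(q, 1)`, with `F` the field of order `q`: the points are the flags
of `PG(2, F)`, the lines are the points and the lines of `PG(2, F)`, and a flag is incident with
its two members. -/
def flagHexagon (F : Type*) [Field F] :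
    PointLineGeometry (PlaneFlag F) (PlanePoint F ⊕ PlaneLine F) where
  inc f l := l = Sum.inl f.1.1 ∨ l = Sum.inr f.1.2

/-- The quadratic form `x₀x₄ + x₁x₅ + x₂x₆ - x₃²` on `F⁷`. -/
def hexQ {F : Type*} [Field F] (x : Fin 7 → F) : F :=
  x 0 * x 4 + x 1 * x 5 + x 2 * x 6 - x 3 ^ 2

/-- The Grassmann coordinate `p_{ij}` of the pair `x, y`. -/
def grassmann {F : Type*} [Field F] (x y : Fin 7 → F) (i j : Fin 7) : F :=
  x i * y j - x j * y i

/-- The six equations on Grassmann coordinates that single out the lines of the quadric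
belonging to the split Cayley hexagon. -/
def GrassmannEquations {F : Type*} [Field F] (x y : Fin 7 → F) : Prop :=
  grassmann x y 1 2 = grassmann x y 3 4 ∧
  grassmann x y 5 4 = grassmann x y 3 2 ∧
  grassmann x y 2 0 = grassmann x y 3 5 ∧
  grassmann x y 6 5 = grassmann x y 3 0 ∧
  grassmann x y 0 1 = grassmann x y 3 6 ∧
  grassmann x y 4 6 = grassmann x y 3 1

/-- The lines of `H(q)^D`: the 1-dimensional subspaces of `F⁷` on which `hexQ` vanishes. -/
def DualCayleyLine (F : Type*) [Field F] : Type _ :=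
  {U : Submodule F (Fin 7 → F) // Module.finrank F U = 1 ∧ ∀ x ∈ U, hexQ x = 0}

/-- The points of `H(q)^D`: the 2-dimensional subspaces of `F⁷` on which `hexQ` vanishes and whose
Grassmann coordinates satisfy the six equations. (The coordinates with respect to two bases
`x, y` differ by a nonzero factor, so it does not matter which basis is used.) -/
def DualCayleyPoint (F : Type*) [Field F] : Type _ :=
  {W : Submodule F (Fin 7 → F) // Module.finrank F W = 2 ∧ (∀ x ∈ W, hexQ x = 0) ∧
    ∀ x y : Fin 7 → F, Submodule.span F {x, y} = W → GrassmannEquations x y}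

/-- The dual split Cayley hexagon `H(q)^D`, with `F` the field of order `q`; incidence is reverse
containment. -/
def dualSplitCayleyHexagon (F : Type*) [Field F] :
    PointLineGeometry (DualCayleyPoint F) (DualCayleyLine F) where
  inc p l := l.1 ≤ p.1

/-! The proof averages over translates of one subhexagon. Write a vector of `F⁷` as `(w, c, z)` with
`w, z ∈ F³`. The points of `H(q)^D` inside the hyperplane `c = 0` are the spans of `(w, 0, 0)` and
`(0, 0, z)` with `w ⬝ᵥ z = 0`, so they correspond to the flags of the plane and form a copy `S` of
`H(q,1)` (`range_flagPoint`, `inc_flagPoint_iff`).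

Every image of `S` under an automorphism is again an `H(q,1)`-subhexagon. Flags of the plane through
a common plane point are collinear, so each of the `q² + q + 1` plane points carries at most one
flag of the ovoid. An image of `S` therefore meets `O` in at most `q² + q + 1` points, hence by
hypothesis in at most `q² + q`.

The automorphism group is transitive on points (`isPretransitive_autGroup`): `SL₃(F)` handles the
points inside the hyperplane and those outside it separately, and one root element joins the two
classes. Double counting then gives `|O| |S| ≤ (q² + q) |P|`, where `P` is the set of all points.
Finally `|P| ≤ |S| (1 + q(q - 1))` (`card_dualCayleyPoint_le`), and cancelling `|S|` gives the
bound. -/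

namespace DualCayley

open PointLineGeometry

/-! ### Double counting over a transitive group. -/

section Averaging

/-- If a finite group acts transitively on a finite set and every translate of `S` meets `O` in at
most `m` elements, then `|O| |S| ≤ m |P|`. -/
theorem card_mul_card_le_of_translates {G P : Type*} [Group G] [Finite G] [Finite P]
    [MulAction G P] [MulAction.IsPretransitive G P] (O S : Set P) (m : ℕ)
    (h : ∀ g : G, (O ∩ (fun s => g • s) '' S).ncard ≤ m) :
    O.ncard * S.ncard ≤ m * Nat.card P := by
  classical
  have := Fintype.ofFinite G
  have := Fintype.ofFinite P
  -- By transitivity, left multiplication matches the fibres of `g ↦ g • s` with each other, so each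
  -- has size `|G| / |P|`; the product form avoids the division.
  have hfib : ∀ s o : P, Fintype.card P * (Finset.univ.filter fun g : G => g • s = o).card =
      Fintype.card G := by
    intro s o
    have hall : ∀ o' : P, (Finset.univ.filter fun g : G => g • s = o').card =
        (Finset.univ.filter fun g : G => g • s = o).card := by
      intro o'
      obtain ⟨k, hk⟩ := MulAction.exists_smul_eq G o' o
      refine Finset.card_bij (fun g _ => k * g) ?_ ?_ ?_
      · intro g hg
        simp only [Finset.mem_filter, Finset.mem_univ, true_and] at hg ⊢
        rw [mul_smul, hg, hk]
      · intro a _ b _ hab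
        exact mul_left_cancel hab
      · intro b hb
        refine ⟨k⁻¹ * b, ?_, by simp⟩
        simp only [Finset.mem_filter, Finset.mem_univ, true_and] at hb ⊢
        rw [mul_smul, hb, ← hk, inv_smul_smul]
    have := Finset.card_eq_sum_card_fiberwise (s := (Finset.univ : Finset G))
      (t := (Finset.univ : Finset P)) (f := fun g => g • s) (fun _ _ => by simp)
    rw [Finset.sum_congr rfl (fun o' _ => hall o'), Finset.sum_const, Finset.card_univ,
      Finset.card_univ, smul_eq_mul] at this
    exact this.symm
  have hO : O.ncard = O.toFinset.card := Set.ncard_eq_toFinset_card' O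
  have hS : S.ncard = S.toFinset.card := Set.ncard_eq_toFinset_card' S
  have hterm : ∀ g : G, (O ∩ (fun s => g • s) '' S).ncard =
      ∑ s ∈ S.toFinset, ∑ o ∈ O.toFinset, if g • s = o then 1 else 0 := by
    intro g
    have h1 : (O ∩ (fun s => g • s) '' S) = (fun s => g • s) '' {s ∈ S | g • s ∈ O} := by
      ext p
      constructor
      · rintro ⟨hp, s, hs, rfl⟩
        exact ⟨s, ⟨hs, hp⟩, rfl⟩
      · rintro ⟨s, ⟨hs, hp⟩, rfl⟩
        exact ⟨hp, s, hs, rfl⟩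
    rw [h1, Set.ncard_image_of_injective _ (MulAction.injective g)]
    have h2 : {s ∈ S | g • s ∈ O} = ((S.toFinset.filter fun s => g • s ∈ O : Finset P) : Set P) := by
      ext; simp
    rw [h2, Set.ncard_coe_finset, Finset.card_filter]
    refine Finset.sum_congr rfl fun s _ => ?_
    simp
  have hsum : ∑ g : G, (O ∩ (fun s => g • s) '' S).ncard =
      ∑ s ∈ S.toFinset, ∑ o ∈ O.toFinset, (Finset.univ.filter fun g : G => g • s = o).card := by
    rw [Finset.sum_congr rfl fun g _ => hterm g, Finset.sum_comm]
    refine Finset.sum_congr rfl fun s _ => ?_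
    rw [Finset.sum_comm]
    refine Finset.sum_congr rfl fun o _ => ?_
    rw [Finset.card_filter]
  have hle : ∑ g : G, (O ∩ (fun s => g • s) '' S).ncard ≤ Fintype.card G * m := by
    have := Finset.sum_le_card_nsmul Finset.univ (fun g : G => (O ∩ (fun s => g • s) '' S).ncard) m
      (fun g _ => h g)
    simpa using this
  have hprod : Fintype.card P * ∑ g : G, (O ∩ (fun s => g • s) '' S).ncard =
      O.ncard * S.ncard * Fintype.card G := by
    rw [hsum, Finset.mul_sum]
    simp_rw [Finset.mul_sum, hfib]
    simp only [Finset.sum_const, smul_eq_mul, hO, hS]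
    ring
  have hG : 0 < Fintype.card G := Fintype.card_pos
  rw [Nat.card_eq_fintype_card]
  refine Nat.le_of_mul_le_mul_right ?_ hG
  calc O.ncard * S.ncard * Fintype.card G
      = Fintype.card P * ∑ g : G, (O ∩ (fun s => g • s) '' S).ncard := hprod.symm
    _ ≤ Fintype.card P * (Fintype.card G * m) := Nat.mul_le_mul_left _ hle
    _ = m * Fintype.card P * Fintype.card G := by ring

end Averaging

/-! ### Automorphisms, subgeometries and ovoids in general. -/

section Automorphisms

variable {P L : Type*}

/-- The automorphism group of a point-line geometry. -/
def autGroup (S : PointLineGeometry P L) : Subgroup (Equiv.Perm P × Equiv.Perm L) where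
  carrier := {g | ∀ x l, S.inc (g.1 x) (g.2 l) ↔ S.inc x l}
  mul_mem' {a b} ha hb x l := by
    simpa using (ha (b.1 x) (b.2 l)).trans (hb x l)
  one_mem' x l := Iff.rfl
  inv_mem' {a} ha x l := by
    have := ha (a.1⁻¹ x) (a.2⁻¹ l)
    simpa using this.symm

instance (S : PointLineGeometry P L) : MulAction (autGroup S) P where
  smul g x := g.1.1 x
  one_smul _ := rfl
  mul_smul _ _ _ := rfl

/-- An incidence-preserving and -reflecting embedding identifies its domain with the induced
subgeometry on its range. -/
theorem nonempty_iso_of_embedding {P₁ L₁ : Type*} {S : PointLineGeometry P L}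
    {T : PointLineGeometry P₁ L₁} (φ : P₁ → P) (ψ : L₁ → L) (hφ : Function.Injective φ)
    (hψ : Function.Injective ψ) (h : ∀ x l, S.inc (φ x) (ψ l) ↔ T.inc x l) :
    Nonempty ((S.induce (Set.range φ) (Set.range ψ)).Iso T) := by
  refine ⟨⟨(Equiv.ofInjective φ hφ).symm, (Equiv.ofInjective ψ hψ).symm, ?_⟩⟩
  rintro ⟨_, x, rfl⟩ ⟨_, l, rfl⟩
  rw [Equiv.ofInjective_symm_apply, Equiv.ofInjective_symm_apply]
  exact h x l

/-- Distinct points of a partial distance-2 ovoid are not on a common line. -/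
theorem not_inc_of_ovoid {S : PointLineGeometry P L} {O : Set P}
    (hO : S.IsPartialDistanceOvoid 2 O) {x y : P} (hx : x ∈ O) (hy : y ∈ O) (l : L)
    (hxl : S.inc x l) (hyl : S.inc y l) : x = y := by
  by_contra hne
  have h1 := hO x hx y hy hne
  have hadj : S.pointGraph.Adj x y := ⟨hne, l, hxl, hyl⟩
  rw [SimpleGraph.edist_eq_one_iff_adj.mpr hadj] at h1
  norm_num at h1

end Automorphisms

end DualCayley

namespace DualCayley

open PointLineGeometry

variable {F : Type*} [Field F]

/-! ### Bases of hexagon points. -/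

section Pairs

theorem finrank_span_pair_eq_two {V : Type*} [AddCommGroup V] [Module F V] {x y : V}
    (h : ∀ a b : F, a • x + b • y = 0 → a = 0 ∧ b = 0) :
    Module.finrank F (Submodule.span F {x, y}) = 2 := by
  have := finrank_span_eq_card (LinearIndependent.pair_iff.mpr h)
  rwa [show Set.range ![x, y] = {x, y} by ext; simp [eq_comm, or_comm],
    Fintype.card_fin] at this

theorem span_pair_eq_of_mem {V : Type*} [AddCommGroup V] [Module F V] [FiniteDimensional F V]
    {W : Submodule F V} (hW : Module.finrank F W = 2) {x y : V} (hx : x ∈ W) (hy : y ∈ W)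
    (h : ∀ a b : F, a • x + b • y = 0 → a = 0 ∧ b = 0) : Submodule.span F {x, y} = W := by
  refine Submodule.eq_of_le_of_finrank_le ?_ ?_
  · rw [Submodule.span_le]
    rintro v (rfl | rfl)
    exacts [hx, hy]
  · rw [finrank_span_pair_eq_two h, hW]

theorem exists_basis_of_finrank_two {V : Type*} [AddCommGroup V] [Module F V]
    {W : Submodule F V} (hW : Module.finrank F W = 2) :
    ∃ x ∈ W, ∃ y ∈ W, ∀ a b : F, a • x + b • y = 0 → a = 0 ∧ b = 0 := by
  have : FiniteDimensional F W := Module.finite_of_finrank_pos (by omega)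
  let b := Module.finBasisOfFinrankEq F W hW
  refine ⟨b 0, (b 0).2, b 1, (b 1).2, ?_⟩
  refine LinearIndependent.pair_iff.mp ?_
  have h := b.linearIndependent.map' W.subtype (Submodule.ker_subtype W)
  convert h using 1
  ext i
  fin_cases i <;> rfl

end Pairs

/-- The polar form of `hexQ`. -/
def hexPolar (x y : Fin 7 → F) : F :=
  x 0 * y 4 + x 4 * y 0 + x 1 * y 5 + x 5 * y 1 + x 2 * y 6 + x 6 * y 2 - 2 * (x 3 * y 3)

/-- `x` and `y` are singular, orthogonal, and all imaginary coordinates of their octonion product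
vanish. -/
structure HexPair (x y : Fin 7 → F) : Prop where
  left : hexQ x = 0
  right : hexQ y = 0
  polar : hexPolar x y = 0
  eqs : GrassmannEquations x y
  diag : grassmann x y 0 4 + grassmann x y 1 5 + grassmann x y 2 6 = 0

theorem hexQ_comb (x y : Fin 7 → F) (a b : F) :
    hexQ (a • x + b • y) = a ^ 2 * hexQ x + b ^ 2 * hexQ y + a * b * hexPolar x y := by
  simp only [hexQ, hexPolar, Pi.add_apply, Pi.smul_apply, smul_eq_mul]
  ring

theorem grassmann_comb (x y : Fin 7 → F) (a b c d : F) (i j : Fin 7) :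
    grassmann (a • x + b • y) (c • x + d • y) i j = (a * d - b * c) * grassmann x y i j := by
  simp only [grassmann, Pi.add_apply, Pi.smul_apply, smul_eq_mul]
  ring

/-- With `x = (w, c, z)` and `y = (w', d, z')`, three of the equations say `w × w' = c z' - d z`.
Pairing with `w` gives `c (w·z' - cd) = 0`, and pairing with `w'` gives `d (w'·z - cd) = 0`. Since
`w·z' + w'·z = 2cd`, the claim follows unless `c = d = 0`. In that case `w × w' = 0`, and the
Binet–Cauchy identity makes the product of `w·z'` and `w'·z` vanish; their sum vanishes too, so both
are zero. This works in every characteristic. -/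
theorem diag_of_grassmannEquations {x y : Fin 7 → F} (hx : hexQ x = 0) (hy : hexQ y = 0)
    (hxy : hexPolar x y = 0) (h : GrassmannEquations x y) :
    grassmann x y 0 4 + grassmann x y 1 5 + grassmann x y 2 6 = 0 := by
  obtain ⟨h1, h2, h3, h4, h5, h6⟩ := h
  simp only [grassmann, hexQ, hexPolar] at *
  have e1 : x 3 * (x 0 * y 4 + x 1 * y 5 + x 2 * y 6 - x 3 * y 3) = 0 := by
    linear_combination -x 0 * h1 - x 1 * h3 - x 2 * h5 + y 3 * hx
  have e2 : y 3 * (y 0 * x 4 + y 1 * x 5 + y 2 * x 6 - x 3 * y 3) = 0 := by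
    linear_combination y 0 * h1 + y 1 * h3 + y 2 * h5 + x 3 * hy
  by_cases hc : x 3 = 0
  · by_cases hd : y 3 = 0
    · have e3 : (x 0 * y 4 + x 1 * y 5 + x 2 * y 6) * (y 0 * x 4 + y 1 * x 5 + y 2 * x 6) = 0 := by
        rw [hc] at hx h1 h3 h5
        rw [hd] at hy h1 h3 h5
        linear_combination (y 0 * y 4 + y 1 * y 5 + y 2 * y 6) * hx -
          (x 5 * y 6 - x 6 * y 5) * h1 - (x 6 * y 4 - x 4 * y 6) * h3
          - (x 4 * y 5 - x 5 * y 4) * h5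
      have e4 : (x 0 * y 4 + x 1 * y 5 + x 2 * y 6) + (y 0 * x 4 + y 1 * x 5 + y 2 * x 6) = 0 := by
        rw [hc] at hxy
        linear_combination hxy
      rcases mul_eq_zero.mp e3 with h0 | h0
      · linear_combination 2 * h0 - e4
      · linear_combination e4 - 2 * h0
    · have := (mul_eq_zero.mp e2).resolve_left hd
      linear_combination hxy - 2 * this
  · have := (mul_eq_zero.mp e1).resolve_left hc
    linear_combination 2 * this - hxy

theorem hexPair_of_mem (p : DualCayleyPoint F) {x y : Fin 7 → F} (hx : x ∈ p.1) (hy : y ∈ p.1)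
    (h : ∀ a b : F, a • x + b • y = 0 → a = 0 ∧ b = 0) : HexPair x y := by
  obtain ⟨W, h2, hQ, hG⟩ := p
  have hx0 := hQ x hx
  have hy0 := hQ y hy
  have hp : hexPolar x y = 0 := by
    have h1 := hexQ_comb x y 1 1
    rw [hQ _ (W.add_mem (W.smul_mem _ hx) (W.smul_mem _ hy)), hx0, hy0] at h1
    linear_combination -h1
  have hG' := hG x y (span_pair_eq_of_mem h2 hx hy h)
  exact ⟨hx0, hy0, hp, hG', diag_of_grassmannEquations hx0 hy0 hp hG'⟩

theorem HexPair.isPoint {x y : Fin 7 → F} (hp : HexPair x y)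
    (h : ∀ a b : F, a • x + b • y = 0 → a = 0 ∧ b = 0) :
    Module.finrank F (Submodule.span F {x, y}) = 2 ∧
      (∀ v ∈ Submodule.span F {x, y}, hexQ v = 0) ∧
      ∀ x' y' : Fin 7 → F, Submodule.span F {x', y'} = Submodule.span F {x, y} →
        GrassmannEquations x' y' := by
  refine ⟨finrank_span_pair_eq_two h, ?_, ?_⟩
  · intro v hv
    obtain ⟨a, b, rfl⟩ := Submodule.mem_span_pair.mp hv
    rw [hexQ_comb, hp.left, hp.right, hp.polar]
    ring
  · intro x' y' hs
    have hx' : x' ∈ Submodule.span F {x, y} := hs ▸ Submodule.subset_span (by simp)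
    have hy' : y' ∈ Submodule.span F {x, y} := hs ▸ Submodule.subset_span (by simp)
    obtain ⟨a, b, rfl⟩ := Submodule.mem_span_pair.mp hx'
    obtain ⟨c, d, rfl⟩ := Submodule.mem_span_pair.mp hy'
    obtain ⟨h1, h2, h3, h4, h5, h6⟩ := hp.eqs
    simp only [GrassmannEquations, grassmann_comb, h1, h2, h3, h4, h5, h6, and_self]

/-- The point of the dual split Cayley hexagon spanned by an independent pair. -/
def HexPair.point {x y : Fin 7 → F} (hp : HexPair x y)
    (h : ∀ a b : F, a • x + b • y = 0 → a = 0 ∧ b = 0) : DualCayleyPoint F :=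
  ⟨Submodule.span F {x, y}, hp.isPoint h⟩

theorem point_ext {p p' : DualCayleyPoint F} (h : p.1 = p'.1) : p = p' := Subtype.ext h

theorem line_ext {l l' : DualCayleyLine F} (h : l.1 = l'.1) : l = l' := Subtype.ext h

theorem HexPair.point_eq {x y : Fin 7 → F} (hp : HexPair x y)
    (h : ∀ a b : F, a • x + b • y = 0 → a = 0 ∧ b = 0) (p : DualCayleyPoint F) (hx : x ∈ p.1)
    (hy : y ∈ p.1) : hp.point h = p :=
  point_ext (span_pair_eq_of_mem p.2.1 hx hy h)

/-! ### From linear maps to automorphisms of the hexagon. -/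

section LinearAutomorphisms

variable [Finite F]

instance : Finite (DualCayleyPoint F) := by
  unfold DualCayleyPoint; infer_instance

instance : Finite (DualCayleyLine F) := by
  unfold DualCayleyLine; infer_instance

/-- An injective linear map that preserves the quadratic form and the pairs spanning points
induces an automorphism of the dual split Cayley hexagon. -/
theorem exists_aut_of_linear (f : (Fin 7 → F) →ₗ[F] (Fin 7 → F)) (hf : Function.Injective f)
    (hQ : ∀ x, hexQ (f x) = hexQ x) (hP : ∀ x y, HexPair x y → HexPair (f x) (f y)) :
    ∃ g : autGroup (dualSplitCayleyHexagon F), ∀ p : DualCayleyPoint F,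
      (g • p).1 = p.1.map f := by
  have hrank : ∀ W : Submodule F (Fin 7 → F),
      Module.finrank F (W.map f) = Module.finrank F W := fun W =>
    (Submodule.equivMapOfInjective f hf W).finrank_eq.symm
  have hpt : ∀ p : DualCayleyPoint F, ∃ p' : DualCayleyPoint F, p'.1 = p.1.map f := by
    intro p
    obtain ⟨x, hx, y, hy, hxy⟩ := exists_basis_of_finrank_two p.2.1
    have hxy' : ∀ a b : F, a • f x + b • f y = 0 → a = 0 ∧ b = 0 := by
      intro a b h0
      apply hxy
      apply hf
      simpa using h0
    refine ⟨(hP x y (hexPair_of_mem p hx hy hxy)).point hxy', ?_⟩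
    exact span_pair_eq_of_mem ((hrank p.1).trans p.2.1) (Submodule.mem_map_of_mem hx)
      (Submodule.mem_map_of_mem hy) hxy'
  have hln : ∀ l : DualCayleyLine F, ∃ l' : DualCayleyLine F, l'.1 = l.1.map f := by
    intro l
    refine ⟨⟨l.1.map f, (hrank l.1).trans l.2.1, ?_⟩, rfl⟩
    rintro _ ⟨x, hx, rfl⟩
    rw [hQ, l.2.2 x hx]
  choose a ha using hpt
  choose b hb using hln
  have hmap := Submodule.map_injective_of_injective hf
  have hai : Function.Injective a := fun p p' h =>
    point_ext (hmap (by rw [← ha, ← ha, h]))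
  have hbi : Function.Injective b := fun p p' h =>
    line_ext (hmap (by rw [← hb, ← hb, h]))
  -- Surjectivity on points and on lines comes for free from finiteness.
  refine ⟨⟨(Equiv.ofBijective a (Finite.injective_iff_bijective.mp hai),
    Equiv.ofBijective b (Finite.injective_iff_bijective.mp hbi)), ?_⟩, ha⟩
  intro p l
  change (b l).1 ≤ (a p).1 ↔ l.1 ≤ p.1
  rw [ha, hb]
  exact Submodule.map_le_map_iff_of_injective hf _ _

end LinearAutomorphisms

end DualCayley

namespace DualCayley

open PointLineGeometry

variable {F : Type*} [Field F]

/-! ### A root element and the action of `SL₃(F)`. -/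

section Generators

/-- A long root element of the automorphism group. -/
def rootMap (F : Type*) [Field F] : (Fin 7 → F) →ₗ[F] (Fin 7 → F) where
  toFun x := ![x 0, x 1 + x 6, x 2 - x 5, x 3 + x 0, x 4 + 2 * x 3 + x 0, x 5, x 6]
  map_add' x y := by
    ext i; fin_cases i <;> simp <;> ring
  map_smul' a x := by
    ext i; fin_cases i <;> simp <;> ring

theorem rootMap_apply (x : Fin 7 → F) : rootMap F x =
    ![x 0, x 1 + x 6, x 2 - x 5, x 3 + x 0, x 4 + 2 * x 3 + x 0, x 5, x 6] := rfl

theorem rootMap_injective : Function.Injective (rootMap F) := by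
  refine (injective_iff_map_eq_zero _).mpr fun x hx => ?_
  have h := fun i => congrFun hx i
  have h0 : x 0 = 0 := h 0
  have h1 : x 1 + x 6 = 0 := h 1
  have h2 : x 2 - x 5 = 0 := h 2
  have h3 : x 3 + x 0 = 0 := h 3
  have h4 : x 4 + 2 * x 3 + x 0 = 0 := h 4
  have h5 : x 5 = 0 := h 5
  have h6 : x 6 = 0 := h 6
  ext i
  fin_cases i
  · exact h0
  · change x 1 = 0; linear_combination h1 - h6
  · change x 2 = 0; linear_combination h2 + h5
  · change x 3 = 0; linear_combination h3 - h0
  · change x 4 = 0; linear_combination h4 - 2 * h3 + h0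
  · exact h5
  · exact h6

theorem hexQ_rootMap (x : Fin 7 → F) : hexQ (rootMap F x) = hexQ x := by
  simp [rootMap_apply, hexQ]
  ring

/-- The six equations are not carried among themselves: the image of the first one involves the
diagonal relation. This is why `HexPair` includes `diag`. -/
theorem HexPair.rootMap {x y : Fin 7 → F} (h : HexPair x y) :
    HexPair (rootMap F x) (rootMap F y) := by
  obtain ⟨hx, hy, hp, ⟨h1, h2, h3, h4, h5, h6⟩, hd⟩ := h
  refine ⟨(hexQ_rootMap x).trans hx, (hexQ_rootMap y).trans hy, ?_, ?_, ?_⟩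
  · simp [hexPolar, rootMap_apply] at hp ⊢
    linear_combination hp
  · simp only [GrassmannEquations, grassmann, rootMap_apply] at *
    simp
    refine ⟨?_, ?_, ?_, ?_, ?_, ?_⟩
    · linear_combination h1 - hd - h4
    · linear_combination h2 + h3
    · linear_combination h3
    · linear_combination h4
    · linear_combination h5
    · linear_combination h6 - h5
  · simp only [grassmann, rootMap_apply] at *
    simp
    linear_combination hd + 2 * h4

/-- The cofactor matrix of a `3 × 3` matrix. -/
def cof (N : Matrix (Fin 3) (Fin 3) F) : Matrix (Fin 3) (Fin 3) F := fun i j =>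
  N (i + 1) (j + 1) * N (i + 2) (j + 2) - N (i + 1) (j + 2) * N (i + 2) (j + 1)

/-- The action of a unimodular matrix `N` on `F³ ⊕ F ⊕ F³`: it acts on the last summand as `N`
and on the first one as the inverse transpose of `N`. -/
def slMap (N : Matrix (Fin 3) (Fin 3) F) : (Fin 7 → F) →ₗ[F] (Fin 7 → F) where
  toFun x := ![cof N 0 0 * x 0 + cof N 0 1 * x 1 + cof N 0 2 * x 2,
    cof N 1 0 * x 0 + cof N 1 1 * x 1 + cof N 1 2 * x 2,
    cof N 2 0 * x 0 + cof N 2 1 * x 1 + cof N 2 2 * x 2, x 3,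
    N 0 0 * x 4 + N 0 1 * x 5 + N 0 2 * x 6,
    N 1 0 * x 4 + N 1 1 * x 5 + N 1 2 * x 6,
    N 2 0 * x 4 + N 2 1 * x 5 + N 2 2 * x 6]
  map_add' x y := by
    ext i; fin_cases i <;> simp <;> ring
  map_smul' a x := by
    ext i; fin_cases i <;> simp <;> ring

theorem slMap_apply (N : Matrix (Fin 3) (Fin 3) F) (x : Fin 7 → F) : slMap N x =
    ![cof N 0 0 * x 0 + cof N 0 1 * x 1 + cof N 0 2 * x 2,
    cof N 1 0 * x 0 + cof N 1 1 * x 1 + cof N 1 2 * x 2,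
    cof N 2 0 * x 0 + cof N 2 1 * x 1 + cof N 2 2 * x 2, x 3,
    N 0 0 * x 4 + N 0 1 * x 5 + N 0 2 * x 6,
    N 1 0 * x 4 + N 1 1 * x 5 + N 1 2 * x 6,
    N 2 0 * x 4 + N 2 1 * x 5 + N 2 2 * x 6] := rfl

theorem cof_dot (N : Matrix (Fin 3) (Fin 3) F) (hN : N.det = 1) (i j : Fin 3) :
    cof N 0 i * N 0 j + cof N 1 i * N 1 j + cof N 2 i * N 2 j = if i = j then 1 else 0 := by
  rw [Matrix.det_fin_three] at hN
  fin_cases i <;> fin_cases j <;> simp [cof, Fin.reduceAdd] <;>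
    first | linear_combination hN | ring

/-- For determinant one, `cof` is the inverse transpose, hence an involution. This lets `cross_mul`
be applied to both `N` and `cof N`. -/
theorem cof_cof (N : Matrix (Fin 3) (Fin 3) F) (hN : N.det = 1) (i j : Fin 3) :
    cof (cof N) i j = N i j := by
  rw [Matrix.det_fin_three] at hN
  fin_cases i <;> fin_cases j <;> simp [cof, Fin.reduceAdd]
  · linear_combination N 0 0 * hN
  · linear_combination N 0 1 * hN
  · linear_combination N 0 2 * hN
  · linear_combination N 1 0 * hN
  · linear_combination N 1 1 * hN
  · linear_combination N 1 2 * hN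
  · linear_combination N 2 0 * hN
  · linear_combination N 2 1 * hN
  · linear_combination N 2 2 * hN

theorem slMap_injective {N : Matrix (Fin 3) (Fin 3) F} (hN : N.det = 1) :
    Function.Injective (slMap N) := by
  refine (injective_iff_map_eq_zero _).mpr fun x hx => ?_
  have h := fun i => congrFun hx i
  have h0 : cof N 0 0 * x 0 + cof N 0 1 * x 1 + cof N 0 2 * x 2 = 0 := h 0
  have h1 : cof N 1 0 * x 0 + cof N 1 1 * x 1 + cof N 1 2 * x 2 = 0 := h 1
  have h2 : cof N 2 0 * x 0 + cof N 2 1 * x 1 + cof N 2 2 * x 2 = 0 := h 2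
  have h3 : x 3 = 0 := h 3
  have h4 : N 0 0 * x 4 + N 0 1 * x 5 + N 0 2 * x 6 = 0 := h 4
  have h5 : N 1 0 * x 4 + N 1 1 * x 5 + N 1 2 * x 6 = 0 := h 5
  have h6 : N 2 0 * x 4 + N 2 1 * x 5 + N 2 2 * x 6 = 0 := h 6
  have d : ∀ i j, _ := cof_dot N hN
  have hw : ∀ i : Fin 3, (if 0 = i then 1 else 0) * x 0 + (if 1 = i then 1 else 0) * x 1 +
      (if 2 = i then 1 else 0) * x 2 = 0 := fun i => by
    rw [← d 0 i, ← d 1 i, ← d 2 i]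
    linear_combination N 0 i * h0 + N 1 i * h1 + N 2 i * h2
  have hz : ∀ i : Fin 3, (if i = 0 then 1 else 0) * x 4 + (if i = 1 then 1 else 0) * x 5 +
      (if i = 2 then 1 else 0) * x 6 = 0 := fun i => by
    rw [← d i 0, ← d i 1, ← d i 2]
    linear_combination cof N 0 i * h4 + cof N 1 i * h5 + cof N 2 i * h6
  ext i
  fin_cases i
  · simpa using hw 0
  · simpa using hw 1
  · simpa using hw 2
  · exact h3
  · simpa using hz 0
  · simpa using hz 1
  · simpa using hz 2

theorem slMap_pairing {N : Matrix (Fin 3) (Fin 3) F} (hN : N.det = 1) (x y : Fin 7 → F) :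
    slMap N x 0 * slMap N y 4 + slMap N x 1 * slMap N y 5 + slMap N x 2 * slMap N y 6 =
      x 0 * y 4 + x 1 * y 5 + x 2 * y 6 := by
  have d := cof_dot N hN
  have d00 := d 0 0
  have d01 := d 0 1
  have d02 := d 0 2
  have d10 := d 1 0
  have d11 := d 1 1
  have d12 := d 1 2
  have d20 := d 2 0
  have d21 := d 2 1
  have d22 := d 2 2
  simp at d00 d01 d02 d10 d11 d12 d20 d21 d22
  simp [slMap_apply]
  linear_combination x 0 * y 4 * d00 + x 0 * y 5 * d01 + x 0 * y 6 * d02 + x 1 * y 4 * d10 +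
    x 1 * y 5 * d11 + x 1 * y 6 * d12 + x 2 * y 4 * d20 + x 2 * y 5 * d21 + x 2 * y 6 * d22

theorem slMap_three (N : Matrix (Fin 3) (Fin 3) F) (x : Fin 7 → F) : slMap N x 3 = x 3 := rfl

theorem hexQ_slMap {N : Matrix (Fin 3) (Fin 3) F} (hN : N.det = 1) (x : Fin 7 → F) :
    hexQ (slMap N x) = hexQ x := by
  simp only [hexQ, slMap_pairing hN, slMap_three]

/-- This is `Na × Nb = cof(N) (a × b)` in coordinates. -/
theorem cross_mul (N : Matrix (Fin 3) (Fin 3) F) (i : Fin 3) (a b : Fin 3 → F) :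
    (N (i + 1) 0 * a 0 + N (i + 1) 1 * a 1 + N (i + 1) 2 * a 2) *
      (N (i + 2) 0 * b 0 + N (i + 2) 1 * b 1 + N (i + 2) 2 * b 2) -
    (N (i + 2) 0 * a 0 + N (i + 2) 1 * a 1 + N (i + 2) 2 * a 2) *
      (N (i + 1) 0 * b 0 + N (i + 1) 1 * b 1 + N (i + 1) 2 * b 2) =
    cof N i 0 * (a 1 * b 2 - a 2 * b 1) + cof N i 1 * (a 2 * b 0 - a 0 * b 2) +
      cof N i 2 * (a 0 * b 1 - a 1 * b 0) := by
  simp only [cof, Fin.reduceAdd]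
  ring

/-- The six equations read `w × w' = c z' - d z` and `z × z' = d w - c w'`. As `w` transforms by
`cof N` and `z` by `N`, `cross_mul` shows that both sides of each transform alike. -/
theorem HexPair.slMap {N : Matrix (Fin 3) (Fin 3) F} (hN : N.det = 1) {x y : Fin 7 → F}
    (h : HexPair x y) : HexPair (slMap N x) (slMap N y) := by
  obtain ⟨hx, hy, hp, ⟨h1, h2, h3, h4, h5, h6⟩, hd⟩ := h
  have e1 := slMap_pairing hN x y
  have e2 := slMap_pairing hN y x
  have c := fun i => cross_mul N i ![x 4, x 5, x 6] ![y 4, y 5, y 6]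
  have c' := fun i => cross_mul (cof N) i ![x 0, x 1, x 2] ![y 0, y 1, y 2]
  have c0 := c 0
  have c1 := c 1
  have c2 := c 2
  have c0' := c' 0
  have c1' := c' 1
  have c2' := c' 2
  simp only [cof_cof N hN, Fin.reduceAdd, Matrix.cons_val] at c0 c1 c2 c0' c1' c2'
  refine ⟨(hexQ_slMap hN x).trans hx, (hexQ_slMap hN y).trans hy, ?_, ?_, ?_⟩
  · simp only [hexPolar, slMap_three] at hp ⊢
    linear_combination hp + e1 + e2
  · simp only [GrassmannEquations, grassmann] at *
    simp only [slMap_apply, Matrix.cons_val]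
    refine ⟨?_, ?_, ?_, ?_, ?_, ?_⟩
    · linear_combination c0' + N 0 0 * h1 + N 0 1 * h3 + N 0 2 * h5
    · linear_combination -c2 + cof N 2 0 * h4 + cof N 2 1 * h6 + cof N 2 2 * h2
    · linear_combination c1' + N 1 0 * h1 + N 1 1 * h3 + N 1 2 * h5
    · linear_combination -c0 + cof N 0 0 * h4 + cof N 0 1 * h6 + cof N 0 2 * h2
    · linear_combination c2' + N 2 0 * h1 + N 2 1 * h3 + N 2 2 * h5
    · linear_combination -c1 + cof N 1 0 * h4 + cof N 1 1 * h6 + cof N 1 2 * h2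
  · simp only [grassmann] at *
    linear_combination hd + e1 - e2

end Generators
end DualCayley

namespace DualCayley

open PointLineGeometry Matrix

variable {F : Type*} [Field F]

/-! ### The decomposition `F⁷ = F³ ⊕ F ⊕ F³` and normal forms of points. -/

section Coordinates

/-- The vector with isotropic parts `w`, `z` and middle coordinate `c`. -/
def vec7 {R : Type*} (w : Fin 3 → R) (c : R) (z : Fin 3 → R) : Fin 7 → R :=
  ![w 0, w 1, w 2, c, z 0, z 1, z 2]

theorem vec7_ext {R : Type*} {w z : Fin 3 → R} {c : R} {x : Fin 7 → R} (h0 : x 0 = w 0)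
    (h1 : x 1 = w 1) (h2 : x 2 = w 2) (h3 : x 3 = c) (h4 : x 4 = z 0) (h5 : x 5 = z 1)
    (h6 : x 6 = z 2) : x = vec7 w c z := by
  ext i
  fin_cases i <;> assumption

theorem vec7_inj {R : Type*} {w z w' z' : Fin 3 → R} {c c' : R}
    (h : vec7 w c z = vec7 w' c' z') : w = w' ∧ c = c' ∧ z = z' := by
  have h := fun i => congrFun h i
  refine ⟨?_, h 3, ?_⟩
  · ext i
    fin_cases i
    exacts [h 0, h 1, h 2]
  · ext i
    fin_cases i
    exacts [h 4, h 5, h 6]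

theorem smul_vec7_add (a b c c' : F) (w z w' z' : Fin 3 → F) :
    a • vec7 w c z + b • vec7 w' c' z' =
      vec7 (a • w + b • w') (a * c + b * c') (a • z + b • z') :=
  vec7_ext rfl rfl rfl rfl rfl rfl rfl

theorem vec7_zero : vec7 0 0 0 = (0 : Fin 7 → F) := by
  ext i; fin_cases i <;> rfl

theorem hexQ_vec7 (w z : Fin 3 → F) (c : F) : hexQ (vec7 w c z) = w ⬝ᵥ z - c ^ 2 := by
  simp [hexQ, vec7, dotProduct, Fin.sum_univ_three]

/-- The hypotheses say `w × w' = 0`. Using a third vector `v` keeps the conclusion valid when `w` or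
`w'` is zero. -/
theorem exists_common_multiple {w w' : Fin 3 → F} (h0 : w 1 * w' 2 = w 2 * w' 1)
    (h1 : w 2 * w' 0 = w 0 * w' 2) (h2 : w 0 * w' 1 = w 1 * w' 0) :
    ∃ (v : Fin 3 → F) (a b : F), w = a • v ∧ w' = b • v := by
  by_cases hw : w = 0
  · exact ⟨w', 0, 1, by simp [hw], by simp⟩
  · obtain ⟨i, hi⟩ := Function.ne_iff.mp hw
    refine ⟨w, 1, w' i / w i, by simp, ?_⟩
    have hi' : w i ≠ 0 := hi
    ext j
    simp only [Pi.smul_apply, smul_eq_mul]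
    field_simp
    fin_cases i <;> fin_cases j <;>
      simp only [Fin.zero_eta, Fin.mk_one, Fin.reduceFinMk] <;>
      first | ring1 | linear_combination h0 | linear_combination h1 | linear_combination h2 |
        linear_combination -h0 | linear_combination -h1 | linear_combination -h2

theorem exists_dotProduct_eq_one {w : Fin 3 → F} (hw : w ≠ 0) : ∃ z, w ⬝ᵥ z = 1 := by
  obtain ⟨i, hi⟩ := Function.ne_iff.mp hw
  have hi' : w i ≠ 0 := hi
  exact ⟨Pi.single i (w i)⁻¹, by simp [dotProduct_single, hi']⟩

theorem flag_pair_independent {w z : Fin 3 → F} (hw : w ≠ 0) (hz : z ≠ 0) (a b : F)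
    (h : a • vec7 w 0 0 + b • vec7 0 0 z = 0) : a = 0 ∧ b = 0 := by
  rw [smul_vec7_add, ← vec7_zero] at h
  obtain ⟨h1, -, h2⟩ := vec7_inj h
  simpa [hw, hz] using And.intro h1 h2

theorem hexPair_flag {w z : Fin 3 → F} (h : w ⬝ᵥ z = 0) :
    HexPair (vec7 w 0 0) (vec7 0 0 z) := by
  have h' : w 0 * z 0 + w 1 * z 1 + w 2 * z 2 = 0 := by
    simpa [dotProduct, Fin.sum_univ_three] using h
  refine ⟨by simp [hexQ_vec7], by simp [hexQ_vec7], ?_, ?_, ?_⟩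
  · simpa [hexPolar, vec7] using h'
  · simp [GrassmannEquations, grassmann, vec7]
  · simpa [grassmann, vec7] using h'

theorem cross_pair_independent {w z w' z' : Fin 3 → F} (hz : z' ≠ 0) (a b : F)
    (h : a • vec7 w 1 z + b • vec7 w' 0 z' = 0) : a = 0 ∧ b = 0 := by
  rw [smul_vec7_add, ← vec7_zero] at h
  obtain ⟨-, h1, h2⟩ := vec7_inj h
  have ha : a = 0 := by simpa using h1
  rw [ha] at h2
  exact ⟨ha, by simpa [hz] using h2⟩

/-- When `c = 1` and `d = 0`, the equation `z × z' = d w - c w'` forces the first part of the second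
vector to be `z' × z`. The other equation then becomes `w × (z' × z) = (w·z) z' - (w·z') z = z'`. -/
theorem hexPair_cross {w z z' : Fin 3 → F} (h : w ⬝ᵥ z = 1) (h' : w ⬝ᵥ z' = 0) :
    HexPair (vec7 w 1 z) (vec7 (z' ⨯₃ z) 0 z') := by
  have e : w 0 * z 0 + w 1 * z 1 + w 2 * z 2 = 1 := by
    simpa [dotProduct, Fin.sum_univ_three] using h
  have e' : w 0 * z' 0 + w 1 * z' 1 + w 2 * z' 2 = 0 := by
    simpa [dotProduct, Fin.sum_univ_three] using h'
  refine ⟨?_, ?_, ?_, ?_, ?_⟩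
  · rw [hexQ_vec7, h]; ring
  · simp [hexQ, vec7, cross_apply]; ring
  · simp [hexPolar, vec7, cross_apply]
    linear_combination e'
  · simp [GrassmannEquations, grassmann, vec7, cross_apply]
    refine ⟨?_, ?_, ?_, ?_, ?_, ?_⟩
    · linear_combination z' 0 * e - z 0 * e'
    · ring
    · linear_combination z' 1 * e - z 1 * e'
    · ring
    · linear_combination z' 2 * e - z 2 * e'
    · ring
  · simp [grassmann, vec7, cross_apply]
    linear_combination e'

end Coordinates

/-! ### Points inside and outside the hyperplane `x₃ = 0`. -/

section Classification

/-- The points of the standard subhexagon: those contained in the hyperplane `x₃ = 0`. -/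
def flagPoints (F : Type*) [Field F] : Set (DualCayleyPoint F) := {p | ∀ x ∈ p.1, x 3 = 0}

/-- When the middle coordinates vanish, the equations become `w × w' = 0` and `z × z' = 0`. Each
projection to a copy of `F³` then has rank at most one, so the point lies in the span of one vector
from each copy. -/
theorem exists_of_mem_flagPoints {p : DualCayleyPoint F} (hp : p ∈ flagPoints F) :
    ∃ w z : Fin 3 → F, w ≠ 0 ∧ z ≠ 0 ∧ w ⬝ᵥ z = 0 ∧ vec7 w 0 0 ∈ p.1 ∧ vec7 0 0 z ∈ p.1 := by
  obtain ⟨x, hx, y, hy, hxy⟩ := exists_basis_of_finrank_two p.2.1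
  obtain ⟨-, -, -, ⟨h1, h2, h3, h4, h5, h6⟩, -⟩ := hexPair_of_mem p hx hy hxy
  have hx3 := hp x hx
  have hy3 := hp y hy
  simp only [grassmann, hx3, hy3, zero_mul, mul_zero, sub_self] at h1 h2 h3 h4 h5 h6
  obtain ⟨w, a, b, hw, hw'⟩ := exists_common_multiple (w := ![x 0, x 1, x 2])
    (w' := ![y 0, y 1, y 2]) (by simp; linear_combination h1) (by simp; linear_combination h3)
    (by simp; linear_combination h5)
  obtain ⟨z, c, d, hz, hz'⟩ := exists_common_multiple (w := ![x 4, x 5, x 6])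
    (w' := ![y 4, y 5, y 6]) (by simp; linear_combination -h4) (by simp; linear_combination -h6)
    (by simp; linear_combination -h2)
  have hxe : x = a • vec7 w 0 0 + c • vec7 0 0 z := by
    rw [smul_vec7_add]
    have e1 := fun i => congrFun hw i
    have e2 := fun i => congrFun hz i
    exact vec7_ext (by simpa using e1 0) (by simpa using e1 1) (by simpa using e1 2) (by simp [hx3])
      (by simpa using e2 0) (by simpa using e2 1) (by simpa using e2 2)
  have hye : y = b • vec7 w 0 0 + d • vec7 0 0 z := by
    rw [smul_vec7_add]
    have e1 := fun i => congrFun hw' i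
    have e2 := fun i => congrFun hz' i
    exact vec7_ext (by simpa using e1 0) (by simpa using e1 1) (by simpa using e1 2) (by simp [hy3])
      (by simpa using e2 0) (by simpa using e2 1) (by simpa using e2 2)
  -- Cramer's rule recovers the two pure vectors, up to the determinant `a * d - b * c`.
  have k1 : d • x + (-c) • y = (a * d - b * c) • vec7 w 0 0 := by
    rw [hxe, hye]; module
  have k2 : (-b) • x + a • y = (a * d - b * c) • vec7 0 0 z := by
    rw [hxe, hye]; module
  have hdet : a * d - b * c ≠ 0 := by
    intro h0
    rw [h0, zero_smul] at k1 k2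
    have h1 := hxy _ _ k1
    have h2 := hxy _ _ k2
    have hx0 : x = 0 := by
      rw [hxe, h2.2, neg_eq_zero.mp h1.2]; simp
    have := hxy 1 0 (by simp [hx0])
    exact one_ne_zero this.1
  have m1 : vec7 w 0 0 ∈ p.1 := by
    have := p.1.add_mem (p.1.smul_mem d hx) (p.1.smul_mem (-c) hy)
    rw [k1] at this
    exact (p.1.smul_mem_iff hdet).mp this
  have m2 : vec7 0 0 z ∈ p.1 := by
    have := p.1.add_mem (p.1.smul_mem (-b) hx) (p.1.smul_mem a hy)
    rw [k2] at this
    exact (p.1.smul_mem_iff hdet).mp this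
  refine ⟨w, z, ?_, ?_, ?_, m1, m2⟩
  · rintro rfl
    rw [vec7_zero, smul_zero] at k1
    have := hxy _ _ k1
    apply hdet
    rw [this.1, neg_eq_zero.mp this.2]; ring
  · rintro rfl
    rw [vec7_zero, smul_zero] at k2
    have := hxy _ _ k2
    apply hdet
    rw [this.2, neg_eq_zero.mp this.1]; ring
  · have := p.2.2.1 _ (p.1.add_mem (p.1.smul_mem 1 m1) (p.1.smul_mem 1 m2))
    rw [smul_vec7_add, hexQ_vec7] at this
    simpa using this

/-- Such a point meets the hyperplane in a one-dimensional subspace. Take one basis vector there and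
scale the other to have middle coordinate `1`; the equations then determine the first part of the
vector in the hyperplane. -/
theorem exists_of_notMem_flagPoints {p : DualCayleyPoint F} (hp : p ∉ flagPoints F) :
    ∃ w z z' : Fin 3 → F, w ⬝ᵥ z = 1 ∧ w ⬝ᵥ z' = 0 ∧ z' ≠ 0 ∧ vec7 w 1 z ∈ p.1 ∧
      vec7 (z' ⨯₃ z) 0 z' ∈ p.1 := by
  obtain ⟨u, hu, v, hv, huv⟩ := exists_basis_of_finrank_two p.2.1
  have hne : ¬ (u 3 = 0 ∧ v 3 = 0) := by
    rintro ⟨hu3, hv3⟩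
    apply hp
    intro x hx
    rw [← span_pair_eq_of_mem p.2.1 hu hv huv] at hx
    obtain ⟨a, b, rfl⟩ := Submodule.mem_span_pair.mp hx
    simp [hu3, hv3]
  have hx : ∃ x ∈ p.1, x 3 = 1 := by
    by_cases hu3 : u 3 = 0
    · have hv3 : v 3 ≠ 0 := fun h => hne ⟨hu3, h⟩
      exact ⟨(v 3)⁻¹ • v, p.1.smul_mem _ hv, by simp [hv3]⟩
    · exact ⟨(u 3)⁻¹ • u, p.1.smul_mem _ hu, by simp [hu3]⟩
  have hy : ∃ y ∈ p.1, y 3 = 0 ∧ y ≠ 0 := by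
    refine ⟨v 3 • u + (-u 3) • v, p.1.add_mem (p.1.smul_mem _ hu) (p.1.smul_mem _ hv), ?_, ?_⟩
    · simp; ring
    · intro h0
      have := huv _ _ h0
      exact hne ⟨neg_eq_zero.mp this.2, this.1⟩
  obtain ⟨x, hx, hx3⟩ := hx
  obtain ⟨y, hy, hy3, hy0⟩ := hy
  have hxy : ∀ a b : F, a • x + b • y = 0 → a = 0 ∧ b = 0 := by
    intro a b h0
    have h3 := congrFun h0 3
    have ha : a = 0 := by simpa [hx3, hy3] using h3
    rw [ha] at h0
    exact ⟨ha, by simpa [hy0] using h0⟩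
  obtain ⟨hqx, -, hpol, ⟨h1, h2, h3, h4, h5, h6⟩, hd⟩ := hexPair_of_mem p hx hy hxy
  simp only [grassmann, hexQ, hexPolar, hx3, hy3] at h1 h2 h3 h4 h5 h6 hqx hpol hd
  have hxe : x = vec7 ![x 0, x 1, x 2] 1 ![x 4, x 5, x 6] :=
    vec7_ext rfl rfl rfl hx3 rfl rfl rfl
  have hye : y = vec7 (![y 4, y 5, y 6] ⨯₃ ![x 4, x 5, x 6]) 0 ![y 4, y 5, y 6] := by
    refine vec7_ext ?_ ?_ ?_ hy3 rfl rfl rfl <;> simp [cross_apply]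
    · linear_combination -h4
    · linear_combination -h6
    · linear_combination -h2
  refine ⟨![x 0, x 1, x 2], ![x 4, x 5, x 6], ![y 4, y 5, y 6], ?_, ?_, ?_, hxe ▸ hx, hye ▸ hy⟩
  · simp [dotProduct, Fin.sum_univ_three]
    linear_combination hqx
  · simp [dotProduct, Fin.sum_univ_three]
    have e0 : y 0 = x 6 * y 5 - x 5 * y 6 := by linear_combination -h4
    have e1 : y 1 = x 4 * y 6 - x 6 * y 4 := by linear_combination -h6
    have e2 : y 2 = x 5 * y 4 - x 4 * y 5 := by linear_combination -h2
    rw [e0, e1, e2] at hd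
    linear_combination hd
  · intro h0
    rw [h0] at hye
    apply hy0
    rw [hye]
    simpa using vec7_zero

end Classification

/-! ### Transitivity of the automorphism group on points. -/

section Transitivity

/-- The columns of `N` are `z`, `z'`, `y`, so the outer cofactor columns are `z' × y` and `z × z'`.
The hypotheses give `(z × z') × w = z'`. If `(z × z')·y = 1` and `w·y = 0`, then `z' × y = ((z × z')
× w) × y = w`. -/
theorem exists_unimodular {w z z' : Fin 3 → F} (h : w ⬝ᵥ z = 1) (h' : w ⬝ᵥ z' = 0)
    (hz : z' ≠ 0) : ∃ N : Matrix (Fin 3) (Fin 3) F, N.det = 1 ∧ (∀ i, N i 0 = z i) ∧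
      (∀ i, N i 1 = z' i) ∧ (∀ i, cof N i 0 = w i) ∧ ∀ i, cof N i 2 = (z ⨯₃ z') i := by
  have e : w 0 * z 0 + w 1 * z 1 + w 2 * z 2 = 1 := by
    simpa [dotProduct, Fin.sum_univ_three] using h
  have e' : w 0 * z' 0 + w 1 * z' 1 + w 2 * z' 2 = 0 := by
    simpa [dotProduct, Fin.sum_univ_three] using h'
  have hc0 : (z ⨯₃ z') ⨯₃ w = z' := by
    rw [cross_apply, cross_apply]
    ext i
    fin_cases i <;> simp
    · linear_combination z' 0 * e - z 0 * e'
    · linear_combination z' 1 * e - z 1 * e'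
    · linear_combination z' 2 * e - z 2 * e'
  have hc : z ⨯₃ z' ≠ 0 := by
    intro h0
    rw [h0] at hc0
    exact hz (by simpa using hc0.symm)
  obtain ⟨y₀, hy₀⟩ := exists_dotProduct_eq_one hc
  -- Subtracting a multiple of `z` corrects `w·y₀` without changing `(z × z')·y₀`.
  obtain ⟨y, hy, hwy⟩ : ∃ y, (z ⨯₃ z') ⬝ᵥ y = 1 ∧ w ⬝ᵥ y = 0 := by
    refine ⟨y₀ - (w ⬝ᵥ y₀) • z, ?_, ?_⟩
    · rw [dotProduct_sub, dotProduct_smul, hy₀, dotProduct_comm _ z, dot_self_cross]; simp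
    · rw [dotProduct_sub, dotProduct_smul, h]; simp
  have e1 : (z 1 * z' 2 - z 2 * z' 1) * y 0 + (z 2 * z' 0 - z 0 * z' 2) * y 1 +
      (z 0 * z' 1 - z 1 * z' 0) * y 2 = 1 := by
    simpa [dotProduct, Fin.sum_univ_three, cross_apply] using hy
  have hcy : z' ⨯₃ y = w := by
    conv_lhs => rw [← hc0]
    rw [cross_cross_eq_smul_sub_smul, hy, hwy]; simp
  refine ⟨Matrix.of fun i => ![z i, z' i, y i], ?_, fun _ => rfl, fun _ => rfl, ?_, ?_⟩
  · rw [Matrix.det_fin_three]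
    simp
    linear_combination e1
  · intro i
    rw [← hcy, cross_apply]
    fin_cases i <;> simp [cof, Fin.reduceAdd] <;> ring
  · intro i
    rw [cross_apply]
    fin_cases i <;> simp [cof, Fin.reduceAdd] <;> ring

theorem slMap_vec7 (N : Matrix (Fin 3) (Fin 3) F) (w z : Fin 3 → F) (c : F) :
    slMap N (vec7 w c z) =
      vec7 (fun i => cof N i 0 * w 0 + cof N i 1 * w 1 + cof N i 2 * w 2) c
        (fun i => N i 0 * z 0 + N i 1 * z 1 + N i 2 * z 2) := rfl

theorem point_eq_of_le {p p' : DualCayleyPoint F} (h : p.1 ≤ p'.1) : p = p' :=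
  point_ext (Submodule.eq_of_le_of_finrank_le h (by rw [p.2.1, p'.2.1]))

theorem isPretransitive_autGroup [Finite F] :
    MulAction.IsPretransitive (autGroup (dualSplitCayleyHexagon F)) (DualCayleyPoint F) := by
  have hp0 : HexPair (vec7 ![1, 0, 0] 0 0) (vec7 0 0 ![0, 1, 0] : Fin 7 → F) :=
    hexPair_flag (by simp)
  have hi0 := flag_pair_independent (F := F) (w := ![1, 0, 0]) (z := ![0, 1, 0]) (by simp) (by simp)
  have key : ∀ (f : (Fin 7 → F) →ₗ[F] (Fin 7 → F)) (p : DualCayleyPoint F),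
      f (vec7 ![1, 0, 0] 0 0) ∈ p.1 → f (vec7 0 0 ![0, 1, 0]) ∈ p.1 →
      (hp0.point hi0).1.map f ≤ p.1 := by
    intro f p h1 h2
    change (Submodule.span F _).map f ≤ p.1
    rw [Submodule.map_span, Submodule.span_le]
    rintro _ ⟨v, rfl | rfl, rfl⟩
    exacts [h1, h2]
  rw [MulAction.isPretransitive_iff_base (hp0.point hi0)]
  intro p
  by_cases hp : p ∈ flagPoints F
  · obtain ⟨w, z', hw, hz', hwz', h1, h2⟩ := exists_of_mem_flagPoints hp
    obtain ⟨z, hwz⟩ := exists_dotProduct_eq_one hw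
    obtain ⟨N, hN, hz0, hz1, hw0, -⟩ := exists_unimodular hwz hwz' hz'
    obtain ⟨g, hg⟩ := exists_aut_of_linear (slMap N) (slMap_injective hN) (hexQ_slMap hN)
      fun x y h => h.slMap hN
    refine ⟨g, point_eq_of_le ?_⟩
    rw [hg]
    refine key _ _ ?_ ?_
    · convert h1 using 1
      rw [slMap_vec7]
      congr 1 <;> ext i <;> simp [hw0]
    · convert h2 using 1
      rw [slMap_vec7]
      congr 1 <;> ext i <;> simp [hz1]
  -- `SL₃(F)` fixes `x₃`, so the root element is needed to leave the hyperplane. It sends the base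
  -- point to the normal form with `w = z = e₀` and `z' = e₁`, where `z' × z = -e₂`; then `N`
  -- carries that to the given triple.
  · obtain ⟨w, z, z', hwz, hwz', hz', h1, h2⟩ := exists_of_notMem_flagPoints hp
    obtain ⟨N, hN, hz0, hz1, hw0, hw2⟩ := exists_unimodular hwz hwz' hz'
    obtain ⟨g, hg⟩ := exists_aut_of_linear ((slMap N).comp (rootMap F))
      ((slMap_injective hN).comp rootMap_injective)
      (fun x => (hexQ_slMap hN _).trans (hexQ_rootMap x)) fun x y h => h.rootMap.slMap hN
    refine ⟨g, point_eq_of_le ?_⟩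
    rw [hg]
    refine key _ _ ?_ ?_
    · convert h1 using 1
      have : rootMap F (vec7 ![1, 0, 0] 0 0) = vec7 ![1, 0, 0] 1 ![1, 0, 0] := by
        refine vec7_ext ?_ ?_ ?_ ?_ ?_ ?_ ?_ <;> simp [rootMap_apply, vec7]
      rw [LinearMap.comp_apply, this, slMap_vec7]
      congr 1 <;> ext i <;> simp [hw0, hz0]
    · convert h2 using 1
      have : rootMap F (vec7 0 0 ![0, 1, 0]) = vec7 ![0, 0, -1] 0 ![0, 1, 0] := by
        refine vec7_ext ?_ ?_ ?_ ?_ ?_ ?_ ?_ <;> simp [rootMap_apply, vec7]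
      rw [LinearMap.comp_apply, this, slMap_vec7, ← cross_anticomm]
      congr 1 <;> ext i <;> simp [hw2, hz1]

end Transitivity

end DualCayley

namespace DualCayley

open PointLineGeometry Matrix

variable {F : Type*} [Field F]

/-! ### Vectors for the points and lines of `PG(2, F)`. -/

section Plane

theorem exists_planePoint_vector (U : PlanePoint F) :
    ∃ w : Fin 3 → F, w ≠ 0 ∧ U.1 = Submodule.span F {w} := by
  obtain ⟨w, hw, h⟩ := finrank_eq_one_iff'.mp U.2
  refine ⟨w, by simpa using hw, le_antisymm ?_ ?_⟩
  · intro x hx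
    obtain ⟨c, hc⟩ := h ⟨x, hx⟩
    exact Submodule.mem_span_singleton.mpr ⟨c, congrArg Subtype.val hc⟩
  · rw [Submodule.span_singleton_le_iff_mem]
    exact w.2

/-- The functional `x ↦ z ⬝ᵥ x`. -/
def dotMap (z : Fin 3 → F) : (Fin 3 → F) →ₗ[F] F where
  toFun x := z ⬝ᵥ x
  map_add' := dotProduct_add z
  map_smul' a x := dotProduct_smul a z x

theorem finrank_ker_dotMap {z : Fin 3 → F} (hz : z ≠ 0) :
    Module.finrank F (LinearMap.ker (dotMap z)) = 2 := by
  have h := LinearMap.finrank_range_add_finrank_ker (dotMap z)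
  have hr : LinearMap.range (dotMap z) = ⊤ := by
    rw [LinearMap.range_eq_top]
    intro c
    obtain ⟨x, hx⟩ := exists_dotProduct_eq_one hz
    exact ⟨c • x, by simp [dotMap, hx]⟩
  rw [hr, finrank_top, Module.finrank_self, Module.finrank_fin_fun] at h
  omega

theorem exists_planeLine_vector (L : PlaneLine F) :
    ∃ z : Fin 3 → F, z ≠ 0 ∧ L.1 = LinearMap.ker (dotMap z) := by
  have hlt : L.1 < ⊤ := by
    refine lt_top_iff_ne_top.mpr fun h => ?_
    have := L.2
    rw [h, finrank_top, Module.finrank_fin_fun] at this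
    omega
  obtain ⟨f, hf, hle⟩ := Submodule.exists_le_ker_of_lt_top _ hlt
  have hfz : f = dotMap (fun i => f (Pi.single i 1)) := by
    refine LinearMap.pi_ext' fun i => LinearMap.ext_ring ?_
    simp [dotMap]
  have hz : (fun i => f (Pi.single i 1)) ≠ 0 := by
    intro h0
    apply hf
    rw [hfz, h0]
    ext; simp [dotMap]
  refine ⟨_, hz, ?_⟩
  rw [hfz] at hle
  exact Submodule.eq_of_le_of_finrank_le hle (by rw [finrank_ker_dotMap hz, L.2])

theorem exists_smul_eq_of_ker_le {u z : Fin 3 → F} (hu : u ≠ 0)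
    (h : LinearMap.ker (dotMap u) ≤ LinearMap.ker (dotMap z)) : ∃ b : F, b • u = z := by
  obtain ⟨x₀, hx₀⟩ := exists_dotProduct_eq_one hu
  refine ⟨z ⬝ᵥ x₀, ?_⟩
  ext i
  have h1 : Pi.single i 1 - (u ⬝ᵥ Pi.single i 1) • x₀ ∈ LinearMap.ker (dotMap u) := by
    simp [LinearMap.mem_ker, dotMap, dotProduct_sub, dotProduct_smul, hx₀]
  have h2 := h h1
  simp [LinearMap.mem_ker, dotMap, dotProduct_sub, dotProduct_smul] at h2
  simp only [Pi.smul_apply, smul_eq_mul]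
  linear_combination -h2

/-- A vector spanning a point of the plane. -/
noncomputable def pointVec (U : PlanePoint F) : Fin 3 → F := (exists_planePoint_vector U).choose

theorem pointVec_ne_zero (U : PlanePoint F) : pointVec U ≠ 0 :=
  (exists_planePoint_vector U).choose_spec.1

theorem planePoint_eq_span (U : PlanePoint F) : U.1 = Submodule.span F {pointVec U} :=
  (exists_planePoint_vector U).choose_spec.2

/-- A normal vector of a line of the plane. -/
noncomputable def lineVec (L : PlaneLine F) : Fin 3 → F := (exists_planeLine_vector L).choose

theorem lineVec_ne_zero (L : PlaneLine F) : lineVec L ≠ 0 :=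
  (exists_planeLine_vector L).choose_spec.1

theorem planeLine_eq_ker (L : PlaneLine F) : L.1 = LinearMap.ker (dotMap (lineVec L)) :=
  (exists_planeLine_vector L).choose_spec.2

theorem planePoint_eq_of_smul {U U' : PlanePoint F} {a : F} (h : pointVec U = a • pointVec U') :
    U = U' := by
  refine Subtype.ext (Submodule.eq_of_le_of_finrank_le ?_ (by rw [U.2, U'.2]))
  rw [planePoint_eq_span U, planePoint_eq_span U', Submodule.span_singleton_le_iff_mem, h]
  exact Submodule.smul_mem _ _ (Submodule.mem_span_singleton_self _)

theorem planeLine_eq_of_smul {L L' : PlaneLine F} {a : F} (h : lineVec L = a • lineVec L') :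
    L = L' := by
  refine Eq.symm (Subtype.ext (Submodule.eq_of_le_of_finrank_le ?_ (by rw [L.2, L'.2])))
  rw [planeLine_eq_ker L, planeLine_eq_ker L', h]
  intro x hx
  have hx : lineVec L' ⬝ᵥ x = 0 := hx
  change (a • lineVec L') ⬝ᵥ x = 0
  rw [smul_dotProduct, hx, smul_zero]

theorem flag_dotProduct (f : PlaneFlag F) : pointVec f.1.1 ⬝ᵥ lineVec f.1.2 = 0 := by
  have h := f.2
  rw [planePoint_eq_span, planeLine_eq_ker, Submodule.span_singleton_le_iff_mem] at h
  rw [dotProduct_comm]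
  exact h

theorem card_planePoint [Finite F] :
    Nat.card (PlanePoint F) = Nat.card F ^ 2 + Nat.card F + 1 := by
  have h := Nat.card_congr (Projectivization.equivSubmodule F (Fin 3 → F))
  rw [Projectivization.card_of_finrank F (Fin 3 → F) (Module.finrank_fin_fun F)] at h
  rw [show Nat.card (PlanePoint F) = _ from h.symm]
  simp [Finset.sum_range_succ]
  ring

instance [Finite F] : Finite (PlanePoint F) := by
  unfold PlanePoint; infer_instance

instance [Finite F] : Finite (PlaneLine F) := by
  unfold PlaneLine; infer_instance

instance [Finite F] : Finite (PlaneFlag F) := by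
  unfold PlaneFlag; infer_instance

end Plane

/-! ### The hyperplane section as a copy of `H(q,1)`. -/

section StandardSubhexagon

/-- The embedding of the flags of the plane into the points of the dual split Cayley hexagon. -/
noncomputable def flagPoint (f : PlaneFlag F) : DualCayleyPoint F :=
  (hexPair_flag (flag_dotProduct f)).point
    (flag_pair_independent (pointVec_ne_zero f.1.1) (lineVec_ne_zero f.1.2))

theorem mem_flagPoint {f : PlaneFlag F} {v : Fin 7 → F} :
    v ∈ (flagPoint f).1 ↔ ∃ a b : F, vec7 (a • pointVec f.1.1) 0 (b • lineVec f.1.2) = v := by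
  change v ∈ Submodule.span F {vec7 (pointVec f.1.1) 0 0, vec7 0 0 (lineVec f.1.2)} ↔ _
  rw [Submodule.mem_span_pair]
  simp only [smul_vec7_add, smul_zero, add_zero, zero_add, mul_zero]

/-- The vector of `F⁷` spanning the line corresponding to a point or line of the plane. -/
noncomputable def elementVec : PlanePoint F ⊕ PlaneLine F → (Fin 7 → F)
  | Sum.inl U => vec7 (pointVec U) 0 0
  | Sum.inr L => vec7 0 0 (lineVec L)

theorem elementVec_ne_zero (l : PlanePoint F ⊕ PlaneLine F) : elementVec l ≠ 0 := by
  rcases l with U | L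
  · intro h
    exact pointVec_ne_zero U (vec7_inj (h.trans vec7_zero.symm)).1
  · intro h
    exact lineVec_ne_zero L (vec7_inj (h.trans vec7_zero.symm)).2.2

theorem hexQ_smul_elementVec (c : F) (l : PlanePoint F ⊕ PlaneLine F) :
    hexQ (c • elementVec l) = 0 := by
  have h := hexQ_comb (elementVec l) 0 c 0
  rw [smul_zero, add_zero] at h
  rw [h]
  rcases l with U | L <;> simp [elementVec, hexQ_vec7]

/-- The embedding of the points and lines of the plane into the lines of the dual split Cayley
hexagon. -/
noncomputable def elementLine (l : PlanePoint F ⊕ PlaneLine F) : DualCayleyLine F :=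
  ⟨Submodule.span F {elementVec l}, finrank_span_singleton (elementVec_ne_zero l), by
    intro x hx
    obtain ⟨c, rfl⟩ := Submodule.mem_span_singleton.mp hx
    exact hexQ_smul_elementVec c l⟩

theorem elementLine_injective : Function.Injective (elementLine (F := F)) := by
  intro l l' h
  have h1 : elementVec l ∈ Submodule.span F {elementVec l'} := by
    have h2 : Submodule.span F {elementVec l} = Submodule.span F {elementVec l'} :=
      congrArg Subtype.val h
    exact h2 ▸ Submodule.mem_span_singleton_self (elementVec l)
  obtain ⟨c, hc⟩ := Submodule.mem_span_singleton.mp h1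
  -- The zero summand puts the equation in the shape that `smul_vec7_add` rewrites.
  have hc : c • elementVec l' + (0 : F) • vec7 0 0 0 = elementVec l := by simpa using hc
  rcases l with U | L <;> rcases l' with U' | L' <;>
    simp only [elementVec, smul_vec7_add] at hc <;> obtain ⟨k1, -, k2⟩ := vec7_inj hc
  · exact congrArg Sum.inl (planePoint_eq_of_smul (by simpa using k1.symm))
  · exact absurd (by simpa using k1.symm) (pointVec_ne_zero U)
  · exact absurd (by simpa using k2.symm) (lineVec_ne_zero L)
  · exact congrArg Sum.inr (planeLine_eq_of_smul (by simpa using k2.symm))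

theorem inc_flagPoint_iff (f : PlaneFlag F) (l : PlanePoint F ⊕ PlaneLine F) :
    (dualSplitCayleyHexagon F).inc (flagPoint f) (elementLine l) ↔ (flagHexagon F).inc f l := by
  change Submodule.span F {elementVec l} ≤ (flagPoint f).1 ↔
    (l = Sum.inl f.1.1 ∨ l = Sum.inr f.1.2)
  rw [Submodule.span_singleton_le_iff_mem, mem_flagPoint]
  constructor
  · rintro ⟨a, b, h⟩
    rcases l with U | L <;> obtain ⟨k1, -, k2⟩ := vec7_inj h
    · exact Or.inl (congrArg Sum.inl (planePoint_eq_of_smul k1.symm))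
    · exact Or.inr (congrArg Sum.inr (planeLine_eq_of_smul k2.symm))
  · rintro (rfl | rfl)
    · exact ⟨1, 0, by simp [elementVec]⟩
    · exact ⟨0, 1, by simp [elementVec]⟩

theorem flagPoint_injective : Function.Injective (flagPoint (F := F)) := by
  intro f f' h
  have h1 := (inc_flagPoint_iff f (Sum.inl f.1.1)).mpr (Or.inl rfl)
  have h2 := (inc_flagPoint_iff f (Sum.inr f.1.2)).mpr (Or.inr rfl)
  rw [h, inc_flagPoint_iff] at h1 h2
  refine Subtype.ext (Prod.ext ?_ ?_)
  · rcases h1 with h1 | h1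
    · exact Sum.inl_injective h1
    · cases h1
  · rcases h2 with h2 | h2
    · cases h2
    · exact Sum.inr_injective h2

/-- The flag of the plane given by a nonzero vector and an orthogonal nonzero normal vector. -/
def mkFlag {w z : Fin 3 → F} (hw : w ≠ 0) (hz : z ≠ 0) (h : w ⬝ᵥ z = 0) : PlaneFlag F :=
  ⟨(⟨Submodule.span F {w}, finrank_span_singleton hw⟩,
    ⟨LinearMap.ker (dotMap z), finrank_ker_dotMap hz⟩), by
      change Submodule.span F {w} ≤ LinearMap.ker (dotMap z)
      rw [Submodule.span_singleton_le_iff_mem]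
      exact (dotProduct_comm z w).trans h⟩

theorem mkFlag_spec {w z : Fin 3 → F} (hw : w ≠ 0) (hz : z ≠ 0) (h : w ⬝ᵥ z = 0) :
    (∃ a : F, a • pointVec (mkFlag hw hz h).1.1 = w) ∧
      ∃ b : F, b • lineVec (mkFlag hw hz h).1.2 = z := by
  constructor
  · rw [← Submodule.mem_span_singleton, ← planePoint_eq_span]
    exact Submodule.mem_span_singleton_self w
  · apply exists_smul_eq_of_ker_le (lineVec_ne_zero _)
    rw [← planeLine_eq_ker]
    exact le_rfl

theorem range_flagPoint : Set.range (flagPoint (F := F)) = flagPoints F := by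
  ext p
  constructor
  · rintro ⟨f, rfl⟩ x hx
    obtain ⟨a, b, rfl⟩ := mem_flagPoint.mp hx
    rfl
  · intro hp
    obtain ⟨w, z, hw, hz, hwz, h1, h2⟩ := exists_of_mem_flagPoints hp
    refine ⟨mkFlag hw hz hwz, ?_⟩
    obtain ⟨⟨a, ha⟩, ⟨b, hb⟩⟩ := mkFlag_spec hw hz hwz
    have m1 : vec7 w 0 0 ∈ (flagPoint (mkFlag hw hz hwz)).1 :=
      mem_flagPoint.mpr ⟨a, 0, by rw [ha]; simp⟩
    have m2 : vec7 0 0 z ∈ (flagPoint (mkFlag hw hz hwz)).1 :=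
      mem_flagPoint.mpr ⟨0, b, by rw [hb]; simp⟩
    have i := flag_pair_independent hw hz
    exact ((hexPair_flag hwz).point_eq i _ m1 m2).symm.trans ((hexPair_flag hwz).point_eq i _ h1 h2)

end StandardSubhexagon

/-! ### Comparing the number of all points with the number in the hyperplane. -/

section Counting

variable (F)

/-- Pairs of nonzero orthogonal vectors. -/
def OrthoPair : Type _ :=
  {y : (Fin 3 → F) × (Fin 3 → F) // y.1 ≠ 0 ∧ y.2 ≠ 0 ∧ y.1 ⬝ᵥ y.2 = 0}

/-- Triples `(w, z, z')` with `w ⬝ᵥ z = 1`, `w ⬝ᵥ z' = 0` and `z' ≠ 0`. -/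
def Triple : Type _ :=
  {t : (Fin 3 → F) × (Fin 3 → F) × (Fin 3 → F) //
    t.1 ⬝ᵥ t.2.1 = 1 ∧ t.1 ⬝ᵥ t.2.2 = 0 ∧ t.2.2 ≠ 0}

variable [Finite F]

instance : Finite (OrthoPair F) := by
  unfold OrthoPair; infer_instance

instance : Finite (Triple F) := by
  unfold Triple; infer_instance

/-- Every orthogonal pair arises from a flag by rescaling its two chosen vectors by units. -/
theorem card_orthoPair_le :
    Nat.card (OrthoPair F) ≤ (flagPoints F).ncard * (Nat.card F - 1) ^ 2 := by
  have hA : (flagPoints F).ncard = Nat.card (PlaneFlag F) := by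
    rw [← range_flagPoint, ← Nat.card_coe_set_eq,
      Nat.card_congr (Equiv.ofInjective _ flagPoint_injective).symm]
  let g : PlaneFlag F × Fˣ × Fˣ → OrthoPair F := fun t =>
    ⟨((t.2.1 : F) • pointVec t.1.1.1, (t.2.2 : F) • lineVec t.1.1.2),
      smul_ne_zero t.2.1.ne_zero (pointVec_ne_zero _),
      smul_ne_zero t.2.2.ne_zero (lineVec_ne_zero _), by
        simp [flag_dotProduct]⟩
  have hg : Function.Surjective g := by
    rintro ⟨⟨w, z⟩, hw, hz, hwz⟩
    obtain ⟨⟨a, ha⟩, ⟨b, hb⟩⟩ := mkFlag_spec hw hz hwz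
    have ha0 : a ≠ 0 := by
      rintro rfl
      exact hw (by simpa using ha.symm)
    have hb0 : b ≠ 0 := by
      rintro rfl
      exact hz (by simpa using hb.symm)
    exact ⟨(mkFlag hw hz hwz, Units.mk0 a ha0, Units.mk0 b hb0), Subtype.ext (Prod.ext ha hb)⟩
  have := Nat.card_le_card_of_surjective g hg
  rwa [Nat.card_prod, Nat.card_prod, Nat.card_units, ← hA, ← pow_two] at this

/-- Fix `z₀` with `w·z₀ = 1`. The vector `z + a z₀` determines `a`, since its product with `w` is `1
+ a`, and then it determines `z`. -/
theorem card_triple_le :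
    Nat.card (Triple F) * Nat.card F ≤ Nat.card (OrthoPair F) * Nat.card F ^ 3 := by
  have hex : ∀ w : Fin 3 → F, ∃ z, w ≠ 0 → w ⬝ᵥ z = 1 := fun w => by
    by_cases hw : w = 0
    · exact ⟨0, fun h => absurd hw h⟩
    · obtain ⟨z, hz⟩ := exists_dotProduct_eq_one hw
      exact ⟨z, fun _ => hz⟩
  choose z₀ hz₀ using hex
  have hne : ∀ t : Triple F, t.1.1 ≠ 0 := by
    rintro ⟨⟨w, z, z'⟩, h, -⟩ (rfl : w = 0)
    simp at h
  let g : Triple F × F → OrthoPair F × (Fin 3 → F) := fun s =>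
    (⟨(s.1.1.1, s.1.1.2.2), hne s.1, s.1.2.2.2, s.1.2.2.1⟩, s.1.1.2.1 + s.2 • z₀ s.1.1.1)
  have hg : Function.Injective g := by
    rintro ⟨t, a⟩ ⟨t', a'⟩ h
    have hw0 := hne t
    have e := t.2.1
    have e' := t'.2.1
    obtain ⟨⟨w, z, z'⟩, ht⟩ := t
    obtain ⟨⟨v, y, y'⟩, ht'⟩ := t'
    have h1 := congrArg (fun r => r.1.1.1) h
    have h2 := congrArg (fun r => r.1.1.2) h
    have h3 := congrArg (fun r => r.2) h
    simp only [g] at h1 h2 h3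
    subst h1 h2
    have h4 := congrArg (fun x => w ⬝ᵥ x) h3
    simp only [dotProduct_add, dotProduct_smul, e, e', hz₀ w hw0] at h4
    have haa : a = a' := by simpa using h4
    subst haa
    have h5 := add_right_cancel h3
    subst h5
    rfl
  have := Nat.card_le_card_of_injective g hg
  rwa [Nat.card_prod, Nat.card_prod, Nat.card_fun, Nat.card_fin] at this

/-- A point outside the hyperplane has at least `q(q - 1)` bases in normal form: add any multiple of
the second vector to the first, and rescale the second by a unit. A basis determines its point, so
different points give different triples. -/
theorem card_compl_flagPoints_le :
    (flagPoints F)ᶜ.ncard * (Nat.card F * (Nat.card F - 1)) ≤ Nat.card (Triple F) := by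
  have hex : ∀ p : ((flagPoints F)ᶜ : Set (DualCayleyPoint F)), ∃ t : Triple F,
      vec7 t.1.1 1 t.1.2.1 ∈ p.1.1 ∧ vec7 (t.1.2.2 ⨯₃ t.1.2.1) 0 t.1.2.2 ∈ p.1.1 := by
    rintro ⟨p, hp⟩
    obtain ⟨w, z, z', h1, h2, h3, m1, m2⟩ := exists_of_notMem_flagPoints hp
    exact ⟨⟨(w, z, z'), h1, h2, h3⟩, m1, m2⟩
  choose T hT1 hT2 using hex
  let g : ((flagPoints F)ᶜ : Set (DualCayleyPoint F)) × F × Fˣ → Triple F := fun s =>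
    ⟨((T s.1).1.1 + s.2.1 • ((T s.1).1.2.2 ⨯₃ (T s.1).1.2.1),
      (T s.1).1.2.1 + s.2.1 • (T s.1).1.2.2, (s.2.2 : F) • (T s.1).1.2.2), by
        obtain ⟨h1, h2, h3⟩ := (T s.1).2
        have k1 : ((T s.1).1.2.2 ⨯₃ (T s.1).1.2.1) ⬝ᵥ (T s.1).1.2.1 = 0 := by
          rw [dotProduct_comm, dot_cross_self]
        have k2 : ((T s.1).1.2.2 ⨯₃ (T s.1).1.2.1) ⬝ᵥ (T s.1).1.2.2 = 0 := by
          rw [dotProduct_comm, dot_self_cross]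
        refine ⟨?_, ?_, smul_ne_zero s.2.2.ne_zero h3⟩
        · simp [dotProduct_add, add_dotProduct, h1, h2, k1, k2]
        · simp [add_dotProduct, h2, k2]⟩
  have hmem : ∀ s, vec7 (g s).1.1 1 (g s).1.2.1 ∈ s.1.1.1 ∧
      vec7 ((g s).1.2.2 ⨯₃ (g s).1.2.1) 0 (g s).1.2.2 ∈ s.1.1.1 := by
    intro s
    constructor
    · have := s.1.1.1.add_mem (s.1.1.1.smul_mem 1 (hT1 s.1)) (s.1.1.1.smul_mem s.2.1 (hT2 s.1))
      rw [smul_vec7_add] at this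
      simpa [g] using this
    · have := s.1.1.1.add_mem (s.1.1.1.smul_mem (s.2.2 : F) (hT2 s.1))
        (s.1.1.1.smul_mem 0 (hT2 s.1))
      rw [smul_vec7_add] at this
      simpa [g] using this
  have hg : Function.Injective g := by
    rintro ⟨p, a, b⟩ ⟨p', a', b'⟩ h
    have hp : p = p' := by
      have i := cross_pair_independent (w := (g (p, a, b)).1.1) (z := (g (p, a, b)).1.2.1)
        (w' := (g (p, a, b)).1.2.2 ⨯₃ (g (p, a, b)).1.2.1) (g (p, a, b)).2.2.2
      have P := hexPair_cross (g (p, a, b)).2.1 (g (p, a, b)).2.2.1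
      have m := hmem (p, a, b)
      have m' := hmem (p', a', b')
      rw [← h] at m'
      exact Subtype.ext ((P.point_eq i p.1 m.1 m.2).symm.trans (P.point_eq i p'.1 m'.1 m'.2))
    subst hp
    have h0 := (T p).2.2.2
    have h1 := congrArg (fun t => t.1.2.1) h
    have h2 := congrArg (fun t => t.1.2.2) h
    simp only [g] at h1 h2
    have ha : a = a' := smul_left_injective F h0 (add_left_cancel h1)
    have hb : b = b' := Units.ext (smul_left_injective F h0 h2)
    rw [ha, hb]
  have := Nat.card_le_card_of_injective g hg
  rwa [Nat.card_prod, Nat.card_prod, Nat.card_units, Nat.card_coe_set_eq] at this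

theorem card_dualCayleyPoint_le :
    Nat.card (DualCayleyPoint F) ≤
      (flagPoints F).ncard * (1 + Nat.card F * (Nat.card F - 1)) := by
  have h1 := card_orthoPair_le F
  have h2 := card_triple_le F
  have h3 := card_compl_flagPoints_le F
  rw [← Set.ncard_add_ncard_compl (flagPoints F), mul_add, mul_one]
  refine Nat.add_le_add_left ?_ _
  have hq : 1 < Nat.card F := Finite.one_lt_card
  generalize (flagPoints F).ncard = A at *
  generalize (flagPoints F)ᶜ.ncard = B at *
  generalize Nat.card (OrthoPair F) = Y at *
  generalize Nat.card (Triple F) = X at *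
  generalize Nat.card F = q at *
  -- Setting `q = r + 1` removes the truncated subtraction; `r > 0` later allows cancelling `q²(q -
  -- 1)`.
  obtain ⟨r, rfl⟩ : ∃ r, q = r + 1 := ⟨q - 1, by omega⟩
  rw [Nat.add_sub_cancel] at *
  have hr : 0 < r := by omega
  refine Nat.le_of_mul_le_mul_right (c := (r + 1) ^ 2 * r) ?_ (by positivity)
  calc B * ((r + 1) ^ 2 * r) = B * ((r + 1) * r) * (r + 1) := by ring
    _ ≤ X * (r + 1) := Nat.mul_le_mul_right _ h3
    _ ≤ Y * (r + 1) ^ 3 := h2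
    _ ≤ A * r ^ 2 * (r + 1) ^ 3 := Nat.mul_le_mul_right _ h1
    _ = A * ((r + 1) * r) * ((r + 1) ^ 2 * r) := by ring

end Counting

/-! ### Translates of the standard subhexagon and the final bound. -/

section Translates

theorem translate_iso (g : autGroup (dualSplitCayleyHexagon F)) :
    Nonempty (((dualSplitCayleyHexagon F).induce (Set.range fun f => g • flagPoint f)
      (Set.range fun l => g.1.2 (elementLine l))).Iso (flagHexagon F)) :=
  nonempty_iso_of_embedding _ _ ((MulAction.injective g).comp flagPoint_injective)
    (g.1.2.injective.comp elementLine_injective) fun f l =>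
      (g.2 _ _).trans (inc_flagPoint_iff f l)

variable [Finite F]

/-- A translate of the standard subhexagon meets a partial distance-2 ovoid in at most
`q² + q + 1` points. -/
theorem ncard_inter_translate_le {O : Set (DualCayleyPoint F)}
    (hO : (dualSplitCayleyHexagon F).IsPartialDistanceOvoid 2 O)
    (g : autGroup (dualSplitCayleyHexagon F)) :
    (O ∩ Set.range fun f => g • flagPoint f).ncard ≤ Nat.card F ^ 2 + Nat.card F + 1 := by
  have h1 : (O ∩ Set.range fun f => g • flagPoint f) =
      (fun f => g • flagPoint f) '' {f | g • flagPoint f ∈ O} := by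
    ext p
    constructor
    · rintro ⟨hp, f, rfl⟩
      exact ⟨f, hp, rfl⟩
    · rintro ⟨f, hf, rfl⟩
      exact ⟨hf, f, rfl⟩
  have h2 : Function.Injective fun f : PlaneFlag F => g • flagPoint f :=
    (MulAction.injective g).comp flagPoint_injective
  rw [h1, Set.ncard_image_of_injective _ h2, ← card_planePoint, ← Set.ncard_univ]
  -- Sending a flag to its plane point is injective on the ovoid, since two flags with the same
  -- plane point are collinear.
  refine Set.ncard_le_ncard_of_injOn (fun f : PlaneFlag F => f.1.1) (fun _ _ => Set.mem_univ _) ?_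
    Set.finite_univ
  intro f hf f' hf' h
  have hinc : ∀ f : PlaneFlag F, (dualSplitCayleyHexagon F).inc (g • flagPoint f)
      (g.1.2 (elementLine (Sum.inl f.1.1))) := fun f =>
    (g.2 _ _).mpr ((inc_flagPoint_iff _ _).mpr (Or.inl rfl))
  have h : f.1.1 = f'.1.1 := h
  have h2 := hinc f'
  rw [← h] at h2
  exact flagPoint_injective (MulAction.injective g (not_inc_of_ovoid hO hf hf' _ (hinc f) h2))

/-- Averaging over the translates of the standard subhexagon bounds a partial distance-2 ovoid
that meets every `H(q, 1)`-subhexagon in fewer than `q² + q + 1` points. -/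
theorem ncard_le_of_forall_subhexagon (q : ℕ) (hq : Nat.card F = q)
    (O : Set (DualCayleyPoint F))
    (hO : (dualSplitCayleyHexagon F).IsPartialDistanceOvoid 2 O)
    (hsub : ∀ (P' : Set (DualCayleyPoint F)) (L' : Set (DualCayleyLine F)),
      Nonempty (((dualSplitCayleyHexagon F).induce P' L').Iso (flagHexagon F)) →
        (O ∩ P').ncard ≠ q ^ 2 + q + 1) :
    (O.ncard : ℤ) ≤ ((q : ℤ) ^ 2 - q + 1) * ((q : ℤ) ^ 2 + q) := by
  subst hq
  have htrans := isPretransitive_autGroup (F := F)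
  have hbound : ∀ g : autGroup (dualSplitCayleyHexagon F),
      (O ∩ (fun s => g • s) '' flagPoints F).ncard ≤ Nat.card F ^ 2 + Nat.card F := by
    intro g
    rw [← range_flagPoint, ← Set.range_comp]
    exact Nat.le_of_lt_succ
      (lt_of_le_of_ne (ncard_inter_translate_le hO g) (hsub _ _ (translate_iso g)))
  have h1 := card_mul_card_le_of_translates O (flagPoints F) _ hbound
  have h2 := card_dualCayleyPoint_le F
  have hOle : O.ncard ≤ Nat.card (DualCayleyPoint F) := by
    rw [← Set.ncard_univ]
    exact Set.ncard_le_ncard (Set.subset_univ O)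
  have hq : 1 < Nat.card F := Finite.one_lt_card
  have key : O.ncard ≤
      (1 + Nat.card F * (Nat.card F - 1)) * (Nat.card F ^ 2 + Nat.card F) := by
    -- If `S` were empty, the counting bound would leave no points at all, so nonemptiness of `S`
    -- need not be proved before cancelling.
    rcases Nat.eq_zero_or_pos (flagPoints F).ncard with h0 | h0
    · rw [h0, zero_mul] at h2
      omega
    · refine Nat.le_of_mul_le_mul_right ?_ h0
      calc _ ≤ _ := h1
        _ ≤ _ := Nat.mul_le_mul_left _ h2
        _ = _ := by ring
  zify [hq.le] at key
  linarith [key]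

end Translates

end DualCayley

theorem mainTheorem5 {F : Type*} [Field F] [Finite F] (q : ℕ) (hq : Nat.card F = q)
    (O : Set (DualCayleyPoint F))
    (hO : (dualSplitCayleyHexagon F).IsPartialDistanceOvoid 2 O)
    (hsub : ∀ (P' : Set (DualCayleyPoint F)) (L' : Set (DualCayleyLine F)),
      Nonempty (((dualSplitCayleyHexagon F).induce P' L').Iso (flagHexagon F)) →
        (O ∩ P').ncard ≠ q ^ 2 + q + 1) :
    (O.ncard : ℤ) ≤ ((q : ℤ) ^ 2 - q + 1) * ((q : ℤ) ^ 2 + q) :=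
  DualCayley.ncard_le_of_forall_subhexagon q hq O hO hsub
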